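/- Let $q,m\ge 0$, $n=q+m$, and let $\mathbb D^d\subset\mathbb C^d$ be the unit polydisc. Let $B=\mathbb D^q\times\mathbb D^m$, with coordinates $x=(x',x'')$, be a flow box of a Lipschitz lamination of dimension $q$: for $a$ in a set $K\subset\mathbb D^m$ (the transversal) the plaques are the pairwise disjoint graphs $L_a=\{x''=h_a(x')\}$, where $h_a:\mathbb D^q\to\mathbb D^m$ is holomorphic, $h_a(0)=a$, $h_a(x')$ is jointly continuous in $(a,x')$, and for every $0<\rho<1$ there is $c=c(\rho)>0$ such that $$c^{-1}\|a-b\|\le \|h_a(x')-h_b(x')\|\le c\,\|a-b\|\qquad (a,b\in K,\ \|x'\|\le\rho).$$ Let $\mu$ be a positive Borel measure, concentrated on $K$, finite on compact subsets of $\mathbb D^m$ and diffuse (i.e. $\mu(\{a\})=0$ for every $a$), and let $T=\int[L_a]\,d\mu(a)$. On $B\times B$, with coordinates $(x,y)$, put $(z,w)=(x,y-x)$, $z=(z',z'')$, $w=(w',w'')$, so that the diagonal is $\{w=0\}$, and use the parameters $\alpha=(\alpha_1,\alpha_2)=(a,b-a)$. In these coordinates $L_a\times L_b$ is the graph $$\Gamma_\alpha=\{(z',f_\alpha(z',w'),w',g_\alpha(z',w'))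 : z'\in\mathbb D^q,\ z'+w'\in\mathbb D^q\},$$ with $f_\alpha(z',w')=h_{\alpha_1}(z')$ and $g_\alpha(z',w')=h_{\alpha_1+\alpha_2}(z'+w')-h_{\alpha_1}(z')$, and $$\mathbf T=T\otimes T=\int[\Gamma_\alpha]\,d\mathfrak M(\alpha),$$ where $\mathfrak M$ is the image of $\mu\otimes\mu$ under $(a,b)\mapsto(a,b-a)$ and $[\Gamma_\alpha]$ is the current of integration on $\Gamma_\alpha$. For $\lambda\in\mathbb C$, $|\lambda|\ge1$, let $A_\lambda(z,w)=(z,\lambda w)$ and $\mathbf T_\lambda=(A_\lambda)_*\mathbf T$. Then there is an open neighbourhood $U$ of the origin in $\mathbb C^n\times\mathbb C^n$, contained in the image under $A_\lambda$ of the box $B\times B$ (in the coordinates $(z,w)$) for all $|\lambda|\ge1$, such that all $\mathbf T_\lambda$ with $|\lambda|\ge 1$ are well-defined currents on $U$ (the defining integrals converge absolutely and define continuous functionals on test forms) and $$\lim_{|\lambda|\to\infty}\mathbf T_\lambda=0\quad\text{weakly on }U,$$ that is, $\langle\mathbf T_\lambda,\varphi\rangle\to0$ for every smooth complex-valued form $\varphi$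 of degree $4q$ with compact support in $U$. -/

import Mathlib

open MeasureTheory Filter Topology TopologicalSpace
open scoped Distributions

noncomputable section

namespace FoliatedCycle

/-- `ℂ^d` with the sup norm, so that the unit polydisc is the unit ball. -/
abbrev Cn (d : ℕ) : Type := Fin d → ℂ

/-- The unit polydisc `𝔻^d`. -/
def polydisc (d : ℕ) : Set (Cn d) := Metric.ball 0 1

/-- `ℂ^n = ℂ^q × ℂ^m` with `m = n - q`; points are written `x = (x', x'')`. -/
abbrev Coord (q m : ℕ) : Type := Cn q × Cn m

/-! ### Forms and currents -/

/-- Complex valued real-alternating `k`-covectors on `V`; a differential form of degree `k` is a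
map `V → Covector V k`. -/
abbrev Covector (V : Type*) [NormedAddCommGroup V] [NormedSpace ℝ V] (k : ℕ) : Type _ :=
  V [⋀^Fin k]→L[ℝ] ℂ

/-- The pull-back `F^* φ` of a differential form. -/
def pullback {V W : Type*} [NormedAddCommGroup V] [NormedSpace ℝ V] [NormedAddCommGroup W]
    [NormedSpace ℝ W] {k : ℕ} (F : V → W) (φ : W → Covector W k) : V → Covector V k :=
  fun p => (φ (F p)).compContinuousLinearMap (fderiv ℝ F p)

/-- The push-forward `⟨F_* S, φ⟩ = ⟨S, F^* φ⟩` of a functional on forms. -/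
def pushforward {V W : Type*} [NormedAddCommGroup V] [NormedSpace ℝ V] [NormedAddCommGroup W]
    [NormedSpace ℝ W] {k : ℕ} (F : V → W) (S : (V → Covector V k) → ℂ) :
    (W → Covector W k) → ℂ :=
  fun φ => S (pullback F φ)

/-- Smooth complex valued `k`-forms with compact support in the open set `U`, with the usual
locally convex inductive limit topology. -/
abbrev TestForm {V : Type*} [NormedAddCommGroup V] [NormedSpace ℝ V] (U : Opens V) (k : ℕ) :
    Type _ :=
  𝓓(U, Covector V k)

/-- Currents of (real) dimension `k` on `U`: continuous linear functionals on test `k`-forms. -/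
abbrev Current {V : Type*} [NormedAddCommGroup V] [NormedSpace ℝ V] (U : Opens V) (k : ℕ) :
    Type _ :=
  TestForm U k →L[ℝ] ℂ

/-- The standard positively oriented real frame `∂/∂x_1, ∂/∂y_1, …, ∂/∂x_d, ∂/∂y_d` of `ℂ^d`. -/
def realFrame (d : ℕ) : Fin (2 * d) → Cn d :=
  fun j => Pi.single ⟨(j : ℕ) / 2, by omega⟩ (if (j : ℕ) % 2 = 0 then 1 else Complex.I)

/-- The standard positively oriented real frame of `ℂ^q × ℂ^q`. -/
def prodFrame (q : ℕ) : Fin (2 * q + 2 * q) → Cn q × Cn q :=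
  Fin.append (fun j => (realFrame q j, 0)) (fun j => (0, realFrame q j))

/-! ### Flow boxes -/

/-- A flow box `B = 𝔻^q × 𝔻^m` of an embedded lamination of dimension `q`, in holomorphic
coordinates `x = (x', x'')`. The plaques are the pairwise disjoint graphs
`L_a = {x'' = h_a(x')}`, where `h_a : 𝔻^q → 𝔻^m` is holomorphic and depends continuously on
`a = h_a(0)`, for `a` in the transversal `K ⊆ 𝔻^m`. Values of `h` for other `a` are irrelevant. -/
structure FlowBox (q m : ℕ) where
  /-- the transversal `K` -/
  transversal : Set (Cn m)
  /-- the functions `h_a` -/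
  h : Cn m → Cn q → Cn m
  transversal_subset : transversal ⊆ polydisc m
  holomorphic : ∀ a ∈ transversal, DifferentiableOn ℂ (h a) (polydisc q)
  mapsTo : ∀ a ∈ transversal, Set.MapsTo (h a) (polydisc q) (polydisc m)
  h_zero : ∀ a ∈ transversal, h a 0 = a
  continuousOn : ContinuousOn (fun p : Cn m × Cn q => h p.1 p.2) (transversal ×ˢ polydisc q)
  disjoint : ∀ a ∈ transversal, ∀ b ∈ transversal, a ≠ b → ∀ x ∈ polydisc q, h a x ≠ h b x

namespace FlowBox

variable {q m : ℕ}

/-- The lamination is (transversally) Lipschitz: `h_a` depends on `a` in a bi-Lipschitz way,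
uniformly over each smaller polydisc. -/
def IsLipschitz (B : FlowBox q m) : Prop :=
  ∀ ρ : ℝ, 0 < ρ → ρ < 1 → ∃ c : ℝ, 0 < c ∧
    ∀ a ∈ B.transversal, ∀ b ∈ B.transversal, ∀ x : Cn q, ‖x‖ ≤ ρ →
      c⁻¹ * ‖a - b‖ ≤ ‖B.h a x - B.h b x‖ ∧ ‖B.h a x - B.h b x‖ ≤ c * ‖a - b‖

/-- `f_α(z', w') = h_{α₁}(z')`. -/
def f (B : FlowBox q m) (α : Cn m × Cn m) (p : Cn q × Cn q) : Cn m :=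
  B.h α.1 p.1

/-- `g_α(z', w') = h_{α₁ + α₂}(z' + w') - h_{α₁}(z')`. -/
def g (B : FlowBox q m) (α : Cn m × Cn m) (p : Cn q × Cn q) : Cn m :=
  B.h (α.1 + α.2) (p.1 + p.2) - B.h α.1 p.1

/-- The parametrization `(z', w') ↦ (z', f_α(z', w'), w', g_α(z', w'))` of `Γ_α`, which is the
product plaque `L_a × L_b`, `a = α₁`, `b = α₁ + α₂`, in the coordinates `(z, w) = (x, y - x)`. -/
def graph (B : FlowBox q m) (α : Cn m × Cn m) (p : Cn q × Cn q) : Coord q m × Coord q m :=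
  ((p.1, B.f α p), (p.2, B.g α p))

end FlowBox

/-- The set of `(z', w') = (x', y' - x')` with `x', y' ∈ 𝔻^q`, over which `Γ_α` is a graph. -/
def graphDomain (q : ℕ) : Set (Cn q × Cn q) :=
  {p | p.1 ∈ polydisc q ∧ p.1 + p.2 ∈ polydisc q}

/-- The product flow box `B × B` in the coordinates `(z, w) = (x, y - x)`. -/
def productBox (q m : ℕ) : Set (Coord q m × Coord q m) :=
  {p | p.1 ∈ polydisc q ×ˢ polydisc m ∧ p.1 + p.2 ∈ polydisc q ×ˢ polydisc m}

/-- The dilation `A_l (z, w) = (z, l w)`. -/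
def dilation {q m : ℕ} (l : ℂ) (p : Coord q m × Coord q m) : Coord q m × Coord q m :=
  (p.1, l • p.2)

/-- The measure `μ ⊗ μ` in the parameters `α = (a, b - a)`. -/
def productMeasure {m : ℕ} (μ : Measure (Cn m)) : Measure (Cn m × Cn m) :=
  (μ.prod μ).map fun p => (p.1, p.2 - p.1)

namespace FlowBox

variable {q m : ℕ}

/-- The density, with respect to Lebesgue measure in `(z', w')`, of the restriction of the form `φ`
to `Γ_α`. -/
def plaqueDensity (B : FlowBox q m) (α : Cn m × Cn m)
    (φ : Coord q m × Coord q m → Covector (Coord q m × Coord q m) (2 * q + 2 * q))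
    (p : Cn q × Cn q) : ℂ :=
  pullback (B.graph α) φ p (prodFrame q)

/-- The current of integration `⟨[Γ_α], φ⟩ = ∫_{Γ_α} φ`. -/
def plaqueCurrent (B : FlowBox q m) (α : Cn m × Cn m)
    (φ : Coord q m × Coord q m → Covector (Coord q m × Coord q m) (2 * q + 2 * q)) : ℂ :=
  ∫ p in graphDomain q, B.plaqueDensity α φ p

/-- The product cycle `T ⊗ T = ∫ [Γ_α] d(μ ⊗ μ)(α)` in the coordinates `(z, w)`. -/
def productCycle (B : FlowBox q m) (μ : Measure (Cn m))
    (φ : Coord q m × Coord q m → Covector (Coord q m × Coord q m) (2 * q + 2 * q)) : ℂ :=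
  ∫ α, B.plaqueCurrent α φ ∂(productMeasure μ)

/-- The integrals that define `⟨T ⊗ T, φ⟩` converge. -/
def PairingConverges (B : FlowBox q m) (μ : Measure (Cn m))
    (φ : Coord q m × Coord q m → Covector (Coord q m × Coord q m) (2 * q + 2 * q)) : Prop :=
  (∀ᵐ α ∂(productMeasure μ), IntegrableOn (B.plaqueDensity α φ) (graphDomain q)) ∧
    Integrable (fun α => B.plaqueCurrent α φ) (productMeasure μ)

end FlowBox

end FoliatedCycle

end

/-!
If `A_l (L_a × L_b)` comes close to the origin, then the plaques `L_a` and `L_b` have points with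
`|x' - y'| = O(1 / |l|)` and `|x'' - y''| = O(1 / |l|)`, so the lower Lipschitz bound gives
`|a - b| ≤ c / |l|`. The upper bound then makes the holomorphic function
`t ↦ h_b (t + w') - h_a t` of size `O(1 / |l|)` on a fixed ball, and by Cauchy's estimate its
derivative is `O(1 / |l|)` as well: this cancels the factor `l` in the slope of the dilated plaque
along `z'`. Hence the tangent vectors along `z'` are bounded, those along `w'` are `O(|l|)`, and
the parameters `(z', w')` that matter fill a volume `O(|l| ^ (-2q))`. The plaques
`A_l (L_a × L_b)` thus have uniformly bounded mass near the origin, and only the pairs `(a, b)`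
with `|a - b| ≤ c / |l|` contribute. The `μ ⊗ μ`-measure of this set tends to that of the
diagonal, which is zero because `μ` is diffuse.
-/

noncomputable section

namespace FoliatedCycle

/-! ### Cauchy estimates -/

section Holomorphic

variable {E F : Type*} [NormedAddCommGroup E] [NormedSpace ℂ E] [NormedAddCommGroup F]
  [NormedSpace ℂ F] {f g : E → F} {x y w : E} {δ M : ℝ}

lemma norm_fderiv_le_of_norm_le (hδ : 0 < δ) (hf : DifferentiableOn ℂ f (Metric.ball x δ))
    (hM : ∀ t ∈ Metric.ball x δ, ‖f t‖ ≤ M) : ‖fderiv ℂ f x‖ ≤ 2 * M / δ := by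
  refine Complex.norm_fderiv_le_div_of_mapsTo_ball hf (fun t ht => ?_) hδ
  rw [mem_closedBall_iff_norm]
  linarith [norm_sub_le (f t) (f x), hM t ht, hM x (Metric.mem_ball_self hδ)]

lemma norm_image_sub_le_of_norm_le {R : ℝ} (hδ : 0 < δ)
    (hf : DifferentiableOn ℂ f (Metric.ball 0 (R + δ)))
    (hM : ∀ t ∈ Metric.ball 0 (R + δ), ‖f t‖ ≤ M) (hx : ‖x‖ ≤ R) (hy : ‖y‖ ≤ R) :
    ‖f y - f x‖ ≤ 2 * M / δ * ‖y - x‖ := by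
  have hsub : ∀ t ∈ Metric.closedBall (0 : E) R, Metric.ball t δ ⊆ Metric.ball 0 (R + δ) :=
    fun t ht => Metric.ball_subset_ball' (by linarith [Metric.mem_closedBall.1 ht])
  refine (convex_closedBall 0 R).norm_image_sub_le_of_norm_fderiv_le (𝕜 := ℂ)
    (fun t ht => ?_) (fun t ht => ?_) (mem_closedBall_zero_iff.2 hx) (mem_closedBall_zero_iff.2 hy)
  · exact hf.differentiableAt (Metric.isOpen_ball.mem_nhds (hsub t ht (Metric.mem_ball_self hδ)))
  · exact norm_fderiv_le_of_norm_le hδ (hf.mono (hsub t ht)) fun s hs => hM s (hsub t ht hs)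

lemma norm_fderiv_add_sub_fderiv_le (hδ : 0 < δ) (hf : DifferentiableOn ℂ f (Metric.ball x δ))
    (hg : DifferentiableOn ℂ g (Metric.ball (x + w) δ))
    (hM : ∀ t ∈ Metric.ball x δ, ‖g (t + w) - f t‖ ≤ M) :
    ‖fderiv ℂ g (x + w) - fderiv ℂ f x‖ ≤ 2 * M / δ := by
  have hgw : DifferentiableOn ℂ (fun t => g (t + w)) (Metric.ball x δ) :=
    hg.comp (by fun_prop) fun t ht => by simpa [dist_add_right] using ht
  have hx := Metric.isOpen_ball.mem_nhds (Metric.mem_ball_self (x := x) hδ)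
  have hderiv : fderiv ℂ (fun t => g (t + w) - f t) x = fderiv ℂ g (x + w) - fderiv ℂ f x := by
    rw [fderiv_fun_sub (hgw.differentiableAt hx) (hf.differentiableAt hx), fderiv_comp_add_right]
  rw [← hderiv]
  exact norm_fderiv_le_of_norm_le hδ (hgw.sub hf) hM

lemma continuousOn_fderiv_of_continuousOn_prod {P : Type*} [TopologicalSpace P] [ProperSpace E]
    {h : P → E → F} {K : Set P} {U : Set E} (hU : IsOpen U)
    (hcont : ContinuousOn (fun p : P × E => h p.1 p.2) (K ×ˢ U))
    (hhol : ∀ a ∈ K, DifferentiableOn ℂ (h a) U) :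
    ContinuousOn (fun p : P × E => fderiv ℂ (h p.1) p.2) (K ×ˢ U) := by
  rintro ⟨a, x⟩ ⟨ha, hx⟩
  obtain ⟨r, hr, hrU⟩ := Metric.isOpen_iff.1 hU x hx
  have hδ : 0 < r / 2 := half_pos hr
  have hball : ∀ y ∈ Metric.ball x (r / 2), Metric.closedBall y (r / 2) ⊆ U := fun y hy =>
    (Metric.closedBall_subset_ball' (by linarith [Metric.mem_ball.1 hy])).trans hrU
  have htranslate : ContinuousOn (fun z : (P × E) × E => h z.1.1 (z.1.2 + z.2))
      ((K ×ˢ Metric.ball x (r / 2)) ×ˢ Metric.closedBall 0 (r / 2)) :=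
    hcont.comp (f := fun z : (P × E) × E => (z.1.1, z.1.2 + z.2)) (by fun_prop)
      fun z hz => ⟨hz.1.1, hball _ hz.1.2 (by simpa using hz.2)⟩
  rw [ContinuousWithinAt, Metric.tendsto_nhds, nhdsWithin_prod_eq, hU.nhdsWithin_eq hx,
    ← Metric.isOpen_ball.nhdsWithin_eq (Metric.mem_ball_self hδ), ← nhdsWithin_prod_eq]
  intro ε hε
  -- By compactness the translates `t ↦ h b (y + t)` converge uniformly on a closed ball.
  obtain ⟨V, hV, hVε⟩ := (isCompact_closedBall (0 : E) (r / 2)).mem_uniformity_of_prod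
    (f := fun (p : P × E) t => h p.1 (p.2 + t)) (q := (a, x)) htranslate
    ⟨ha, Metric.mem_ball_self hδ⟩
    (Metric.dist_mem_uniformity (show 0 < ε * r / 8 by positivity))
  filter_upwards [hV, self_mem_nhdsWithin] with ⟨b, y⟩ hby ⟨hb, hy⟩
  have hM : ∀ t ∈ Metric.ball x (r / 2), ‖h b (t + (y - x)) - h a t‖ ≤ ε * r / 8 := fun t ht => by
    have hclose := hVε _ hby (t - x) (mem_closedBall_zero_iff.2 (mem_ball_iff_norm.1 ht).le)
    rw [← dist_eq_norm]
    simpa [add_sub_left_comm] using (Set.mem_ofPred.1 hclose).le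
  have hbound := norm_fderiv_add_sub_fderiv_le hδ
    ((hhol a ha).mono (Metric.ball_subset_closedBall.trans (hball x (Metric.mem_ball_self hδ))))
    ((hhol b hb).mono (by
      simpa using Metric.ball_subset_closedBall.trans (hball y hy))) hM
  rw [add_sub_cancel, ← dist_eq_norm] at hbound
  refine hbound.trans_lt ?_
  rw [show 2 * (ε * r / 8) / (r / 2) = ε / 2 by field_simp; norm_num]
  exact half_lt_self hε

end Holomorphic

/-! ### Neighbourhoods of the diagonal -/

section Measure

lemma sigmaFinite_of_isSigmaCompact {X : Type*} [TopologicalSpace X] [MeasurableSpace X]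
    {μ : Measure X} {U : Set X} (hU : IsSigmaCompact U) (hμ : μ Uᶜ = 0)
    (hfin : ∀ C ⊆ U, IsCompact C → μ C < ⊤) : SigmaFinite μ := by
  obtain ⟨C, hC, hCU⟩ := hU
  refine Measure.sigmaFinite_of_countable (S := insert Uᶜ (Set.range C))
    ((Set.countable_range C).insert _) ?_ (by simp [Set.sUnion_range, hCU])
  rintro _ (rfl | ⟨n, rfl⟩)
  · simp [hμ]
  · exact hfin _ (hCU ▸ Set.subset_iUnion C n) (hC n)

lemma isSigmaCompact_of_isOpen {X : Type*} [TopologicalSpace X] [LocallyCompactSpace X]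
    [SecondCountableTopology X] {U : Set X} (hU : IsOpen U) : IsSigmaCompact U :=
  have := hU.locallyCompactSpace
  isSigmaCompact_iff_sigmaCompactSpace.2 inferInstance

lemma prod_diagonal_eq_zero {X : Type*} [MeasurableSpace X] [MeasurableEq X] {μ : Measure X}
    [SFinite μ] [NullSingletonClass μ] : μ.prod μ (Set.diagonal X) = 0 := by
  rw [Measure.measure_prod_null measurableSet_diagonal]
  refine Eventually.of_forall fun a => ?_
  have hfibre : Prod.mk a ⁻¹' Set.diagonal X = {a} := by ext; simp [eq_comm]
  simp [hfibre]

/-- The pairs of points of `C` at distance at most `ε`. -/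
def nearDiagonal {X : Type*} [PseudoMetricSpace X] (C : Set X) (ε : ℝ) : Set (X × X) :=
  {s ∈ C ×ˢ C | dist s.1 s.2 ≤ ε}

lemma measurableSet_nearDiagonal {X : Type*} [PseudoMetricSpace X] [SecondCountableTopology X]
    [MeasurableSpace X] [OpensMeasurableSpace X] {C : Set X} (hC : MeasurableSet C) (ε : ℝ) :
    MeasurableSet (nearDiagonal C ε) :=
  (hC.prod hC).inter (measurableSet_le measurable_dist measurable_const)

lemma prod_nearDiagonal_lt_top {X : Type*} [PseudoMetricSpace X] [MeasurableSpace X]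
    {μ : Measure X} [SFinite μ] {C : Set X} (hC : μ C < ⊤) (ε : ℝ) :
    μ.prod μ (nearDiagonal C ε) < ⊤ := by
  refine (measure_mono (Set.sep_subset _ _)).trans_lt ?_
  rw [Measure.prod_prod]
  exact ENNReal.mul_lt_top hC hC

lemma tendsto_prod_nearDiagonal {X : Type*} [MetricSpace X] [SecondCountableTopology X]
    [MeasurableSpace X] [OpensMeasurableSpace X] {μ : Measure X} [SFinite μ]
    [NullSingletonClass μ] {C : Set X} (hCm : MeasurableSet C) (hC : μ C < ⊤) :
    Tendsto (fun ε => μ.prod μ (nearDiagonal C ε)) (𝓝[>] 0) (𝓝 0) := by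
  have hinter : μ.prod μ (⋂ ε > (0 : ℝ), nearDiagonal C ε) = 0 := by
    refine measure_mono_null (fun s hs => ?_) (prod_diagonal_eq_zero (μ := μ))
    simp only [Set.mem_iInter] at hs
    exact dist_le_zero.1 (le_of_forall_gt_imp_ge_of_dense fun ε hε => (hs ε hε).2)
  rw [← hinter]
  exact tendsto_measure_biInter_gt
    (fun ε _ => (measurableSet_nearDiagonal hCm ε).nullMeasurableSet)
    (fun _ _ _ hij s hs => ⟨hs.1, hs.2.trans hij⟩)
    ⟨1, one_pos, (prod_nearDiagonal_lt_top hC 1).ne⟩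

end Measure

lemma aestronglyMeasurable_setIntegral_of_continuousOn_prod {X Y E : Type*}
    [TopologicalSpace X] [MeasurableSpace X] [OpensMeasurableSpace X] [SecondCountableTopology X]
    [TopologicalSpace Y] [MeasurableSpace Y] [OpensMeasurableSpace Y] [SecondCountableTopology Y]
    [NormedAddCommGroup E] [NormedSpace ℝ E] [SecondCountableTopologyEither X E]
    {μ : Measure X} {ν : Measure Y} [SFinite μ] [SFinite ν] {S : Set X} {D : Set Y} {f : X → Y → E}
    (hS : μ Sᶜ = 0) (hD : MeasurableSet D)
    (hf : ContinuousOn (fun p : X × Y => f p.1 p.2) (S ×ˢ D)) :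
    AEStronglyMeasurable (fun x => ∫ y in D, f x y ∂ν) μ := by
  obtain ⟨Z, hZ, hZm, hZ0⟩ := exists_measurable_superset_of_null hS
  have hmeas := (hf.mono (Set.prod_mono_left (Set.compl_subset_comm.1 hZ))).aestronglyMeasurable
    (μ := μ.prod ν) (hZm.compl.prod hD)
  rw [← Measure.prod_restrict,
    Measure.restrict_eq_self_of_ae_mem (s := Zᶜ) (compl_mem_ae_iff.2 hZ0)] at hmeas
  exact hmeas.integral_prod_right'

/-! ### Norms of forms and pull-backs -/

section Forms

variable {V W X : Type*} [NormedAddCommGroup V] [NormedSpace ℝ V] [NormedAddCommGroup W]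
  [NormedSpace ℝ W] [NormedAddCommGroup X] [NormedSpace ℝ X] {k : ℕ}

lemma pullback_add (F : V → W) (φ ψ : W → Covector W k) :
    pullback F (φ + ψ) = pullback F φ + pullback F ψ :=
  rfl

lemma pullback_smul (F : V → W) (r : ℝ) (φ : W → Covector W k) :
    pullback F (r • φ) = r • pullback F φ :=
  rfl

lemma pullback_pullback_apply {F : V → W} {G : W → X} {p : V} (φ : X → Covector X k)
    (hG : DifferentiableAt ℝ G (F p)) (hF : DifferentiableAt ℝ F p) :
    pullback F (pullback G φ) p = pullback (G ∘ F) φ p := by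
  simp only [pullback, fderiv_comp p hG hF]
  rfl

lemma norm_realFrame (d : ℕ) (j : Fin (2 * d)) : ‖realFrame d j‖ = 1 := by
  rw [realFrame, Pi.norm_single]
  split_ifs <;> simp

lemma norm_apply_prodFrame_le {q : ℕ} {A A' : ℝ} {L : Cn q × Cn q → W}
    (ω : Covector W (2 * q + 2 * q)) (hA : ∀ v, ‖L (v, 0)‖ ≤ A * ‖v‖)
    (hA' : ∀ v, ‖L (0, v)‖ ≤ A' * ‖v‖) :
    ‖ω fun j => L (prodFrame q j)‖ ≤ ‖ω‖ * (A ^ (2 * q) * A' ^ (2 * q)) := by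
  have hbase : ∏ j, ‖L (realFrame q j, 0)‖ ≤ A ^ (2 * q) :=
    (Finset.prod_le_prod (g := fun _ => A) (fun _ _ => norm_nonneg _) fun j _ => by
      simpa [norm_realFrame] using hA (realFrame q j)).trans_eq (by simp)
  have hfibre : ∏ j, ‖L (0, realFrame q j)‖ ≤ A' ^ (2 * q) :=
    (Finset.prod_le_prod (g := fun _ => A') (fun _ _ => norm_nonneg _) fun j _ => by
      simpa [norm_realFrame] using hA' (realFrame q j)).trans_eq (by simp)
  refine (ω.le_opNorm _).trans (mul_le_mul_of_nonneg_left ?_ (norm_nonneg ω))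
  simp only [Fin.prod_univ_add, prodFrame, Fin.append_left, Fin.append_right]
  have hpos := Finset.prod_nonneg fun (j : Fin (2 * q)) (_ : j ∈ Finset.univ) =>
    norm_nonneg (L (realFrame q j, 0))
  exact mul_le_mul hbase hfibre (by positivity) (hpos.trans hbase)

end Forms

namespace TestForm

variable {V : Type*} [NormedAddCommGroup V] [NormedSpace ℝ V] {U : Opens V} {k : ℕ}

/-- The supremum over `y` of the operator norms `‖φ y‖`. -/
def supNorm (φ : TestForm U k) : ℝ :=
  ‖TestFunction.toBoundedContinuousFunctionCLM ℝ φ‖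

lemma supNorm_nonneg (φ : TestForm U k) : 0 ≤ supNorm φ :=
  norm_nonneg _

lemma norm_apply_le_supNorm (φ : TestForm U k) (y : V) : ‖φ y‖ ≤ supNorm φ :=
  (TestFunction.toBoundedContinuousFunctionCLM ℝ φ).norm_coe_le_norm y

lemma mem_of_apply_ne_zero {φ : TestForm U k} {y : V} (hy : φ y ≠ 0) : y ∈ U :=
  φ.tsupport_subset (subset_tsupport φ hy)

lemma continuous_of_norm_le_supNorm {S : TestForm U k →ₗ[ℝ] ℂ} {C : ℝ}
    (hS : ∀ φ, ‖S φ‖ ≤ C * supNorm φ) : Continuous S := by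
  refine continuous_of_continuousAt_zero S ?_
  have hsup : Continuous fun φ : TestForm U k => C * supNorm φ :=
    continuous_const.mul (TestFunction.toBoundedContinuousFunctionCLM ℝ).continuous.norm
  rw [ContinuousAt, map_zero]
  exact squeeze_zero_norm hS (by
    simpa only [supNorm, map_zero, norm_zero, mul_zero] using hsup.tendsto 0)

end TestForm

/-! ### Dilated plaques -/

namespace FlowBox

variable {q m : ℕ} {B : FlowBox q m}

lemma differentiableAt_h {a : Cn m} (ha : a ∈ B.transversal) {x : Cn q} (hx : x ∈ polydisc q) :
    DifferentiableAt ℂ (B.h a) x :=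
  (B.holomorphic a ha).differentiableAt (Metric.isOpen_ball.mem_nhds hx)

lemma norm_h_lt_one {a : Cn m} (ha : a ∈ B.transversal) {x : Cn q} (hx : x ∈ polydisc q) :
    ‖B.h a x‖ < 1 :=
  mem_ball_zero_iff.1 (B.mapsTo a ha hx)

lemma norm_fderiv_h_le {a : Cn m} (ha : a ∈ B.transversal) {x : Cn q} (hx : ‖x‖ ≤ 1 / 2) :
    ‖fderiv ℂ (B.h a) x‖ ≤ 4 := by
  have hsub : Metric.ball x (1 / 2) ⊆ polydisc q :=
    Metric.ball_subset_ball' (by rw [dist_zero_right]; linarith)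
  have hcauchy := norm_fderiv_le_of_norm_le one_half_pos ((B.holomorphic a ha).mono hsub)
    fun t ht => (norm_h_lt_one ha (hsub ht)).le
  linarith

lemma norm_h_sub_h_le {a : Cn m} (ha : a ∈ B.transversal) {x y : Cn q} (hx : ‖x‖ ≤ 1 / 2)
    (hy : ‖y‖ ≤ 1 / 2) : ‖B.h a y - B.h a x‖ ≤ 4 * ‖y - x‖ := by
  have hball : Metric.ball 0 (1 / 2 + 1 / 2) = polydisc q := by rw [add_halves, polydisc]
  have hlip := norm_image_sub_le_of_norm_le one_half_pos (hball ▸ B.holomorphic a ha)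
    (fun t ht => (norm_h_lt_one ha (hball ▸ ht)).le) hx hy
  linarith

lemma norm_le_norm_h_add {a : Cn m} (ha : a ∈ B.transversal) {x : Cn q} (hx : ‖x‖ ≤ 1 / 2) :
    ‖a‖ ≤ ‖B.h a x‖ + 4 * ‖x‖ := by
  have hlip := norm_h_sub_h_le ha hx (y := 0) (by norm_num)
  rw [B.h_zero a ha, zero_sub, norm_neg] at hlip
  linarith [norm_sub_norm_le a (B.h a x)]

/-- The bi-Lipschitz condition of `IsLipschitz`, over the polydisc of a single radius `ρ`. -/
def IsBiLipschitzOn (B : FlowBox q m) (ρ c : ℝ) : Prop :=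
  0 < c ∧ ∀ a ∈ B.transversal, ∀ b ∈ B.transversal, ∀ x : Cn q, ‖x‖ ≤ ρ →
    c⁻¹ * ‖a - b‖ ≤ ‖B.h a x - B.h b x‖ ∧ ‖B.h a x - B.h b x‖ ≤ c * ‖a - b‖

lemma IsBiLipschitzOn.mono {ρ ρ' c : ℝ} (h : B.IsBiLipschitzOn ρ c) (hρ : ρ' ≤ ρ) :
    B.IsBiLipschitzOn ρ' c :=
  ⟨h.1, fun a ha b hb x hx => h.2 a ha b hb x (hx.trans hρ)⟩

/-- The parametrization `A_l ∘ graph (a, b - a)` of the dilated product plaque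
`A_l (L_a × L_b)`. -/
def dilatedGraph (B : FlowBox q m) (l : ℂ) (a b : Cn m) (p : Cn q × Cn q) :
    Coord q m × Coord q m :=
  ((p.1, B.h a p.1), (l • p.2, l • (B.h b (p.1 + p.2) - B.h a p.1)))

lemma hasFDerivAt_dilatedGraph {a b : Cn m} (ha : a ∈ B.transversal) (hb : b ∈ B.transversal)
    {p : Cn q × Cn q} (hp : p ∈ graphDomain q) (l : ℂ) :
    HasFDerivAt (𝕜 := ℂ) (B.dilatedGraph l a b)
      (((ContinuousLinearMap.fst ℂ (Cn q) (Cn q)).prod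
          ((fderiv ℂ (B.h a) p.1).comp (.fst ℂ (Cn q) (Cn q)))).prod
        ((l • ContinuousLinearMap.snd ℂ (Cn q) (Cn q)).prod
          (l • ((fderiv ℂ (B.h b) (p.1 + p.2)).comp (.fst ℂ (Cn q) (Cn q) + .snd ℂ (Cn q) (Cn q)) -
            (fderiv ℂ (B.h a) p.1).comp (.fst ℂ (Cn q) (Cn q)))))) p := by
  have hfst : HasFDerivAt (fun p : Cn q × Cn q => B.h a p.1) _ p :=
    (differentiableAt_h ha hp.1).hasFDerivAt.comp p hasFDerivAt_fst
  have hsum : HasFDerivAt (fun p : Cn q × Cn q => B.h b (p.1 + p.2)) _ p :=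
    HasFDerivAt.comp (f := fun p : Cn q × Cn q => p.1 + p.2) p
      (differentiableAt_h hb hp.2).hasFDerivAt (hasFDerivAt_fst.add hasFDerivAt_snd)
  exact (hasFDerivAt_fst.prodMk hfst).prodMk
    ((hasFDerivAt_snd.const_smul l).prodMk ((hsum.sub hfst).const_smul l))

lemma fderiv_dilatedGraph_apply {a b : Cn m} (ha : a ∈ B.transversal) (hb : b ∈ B.transversal)
    {p : Cn q × Cn q} (hp : p ∈ graphDomain q) (l : ℂ) (v : Cn q × Cn q) :
    fderiv ℝ (B.dilatedGraph l a b) p v = ((v.1, fderiv ℂ (B.h a) p.1 v.1),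
      (l • v.2, l • (fderiv ℂ (B.h b) (p.1 + p.2) (v.1 + v.2) - fderiv ℂ (B.h a) p.1 v.1))) := by
  rw [((hasFDerivAt_dilatedGraph ha hb hp l).restrictScalars ℝ).fderiv]
  rfl

lemma dilation_comp_graph (B : FlowBox q m) (l : ℂ) (a b : Cn m) :
    dilation l ∘ B.graph (a, b - a) = B.dilatedGraph l a b := by
  funext p
  simp [dilation, graph, f, g, dilatedGraph]

lemma plaqueDensity_pullback_dilation {a b : Cn m} (ha : a ∈ B.transversal)
    (hb : b ∈ B.transversal) {p : Cn q × Cn q} (hp : p ∈ graphDomain q) (l : ℂ)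
    (φ : Coord q m × Coord q m → Covector (Coord q m × Coord q m) (2 * q + 2 * q)) :
    B.plaqueDensity (a, b - a) (pullback (dilation l) φ) p =
      φ (B.dilatedGraph l a b p) fun j => fderiv ℝ (B.dilatedGraph l a b) p (prodFrame q j) := by
  have hdilation : DifferentiableAt ℝ (dilation (q := q) (m := m) l) (B.graph (a, b - a) p) := by
    unfold dilation
    fun_prop
  have hgraph : DifferentiableAt ℝ (B.graph (a, b - a)) p := by
    have hone : dilation 1 ∘ B.graph (a, b - a) = B.graph (a, b - a) := by
      funext p; simp [dilation]
    rw [← hone, dilation_comp_graph]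
    exact ((hasFDerivAt_dilatedGraph ha hb hp 1).restrictScalars ℝ).differentiableAt
  rw [plaqueDensity, pullback_pullback_apply φ hdilation hgraph, dilation_comp_graph]
  rfl

lemma continuousOn_plaqueDensity (B : FlowBox q m) (l : ℂ)
    {φ : Coord q m × Coord q m → Covector (Coord q m × Coord q m) (2 * q + 2 * q)}
    (hφ : Continuous φ) :
    ContinuousOn (fun s : (Cn m × Cn m) × (Cn q × Cn q) =>
        B.plaqueDensity (s.1.1, s.1.2 - s.1.1) (pullback (dilation l) φ) s.2)
      ((B.transversal ×ˢ B.transversal) ×ˢ graphDomain q) := by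
  have hma : Set.MapsTo (fun s : (Cn m × Cn m) × (Cn q × Cn q) => (s.1.1, s.2.1))
      ((B.transversal ×ˢ B.transversal) ×ˢ graphDomain q) (B.transversal ×ˢ polydisc q) :=
    fun s hs => ⟨hs.1.1, hs.2.1⟩
  have hmb : Set.MapsTo (fun s : (Cn m × Cn m) × (Cn q × Cn q) => (s.1.2, s.2.1 + s.2.2))
      ((B.transversal ×ˢ B.transversal) ×ˢ graphDomain q) (B.transversal ×ˢ polydisc q) :=
    fun s hs => ⟨hs.1.2, hs.2.2⟩
  have hfderiv := continuousOn_fderiv_of_continuousOn_prod Metric.isOpen_ball B.continuousOn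
    B.holomorphic
  have ha := B.continuousOn.comp (by fun_prop) hma
  have hb := B.continuousOn.comp (by fun_prop) hmb
  have hDa := hfderiv.comp (by fun_prop) hma
  have hDb := hfderiv.comp (by fun_prop) hmb
  simp only [Function.comp_def] at ha hb hDa hDb
  have hpoint : ContinuousOn (fun s : (Cn m × Cn m) × (Cn q × Cn q) =>
      φ (B.dilatedGraph l s.1.1 s.1.2 s.2))
      ((B.transversal ×ˢ B.transversal) ×ˢ graphDomain q) := by
    unfold dilatedGraph
    exact hφ.comp_continuousOn (by fun_prop)
  have htangent : ContinuousOn (fun (s : (Cn m × Cn m) × (Cn q × Cn q)) j =>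
      fderiv ℝ (B.dilatedGraph l s.1.1 s.1.2) s.2 (prodFrame q j))
      ((B.transversal ×ˢ B.transversal) ×ˢ graphDomain q) := by
    refine continuousOn_pi.2 fun j => ContinuousOn.congr ?_
      fun s hs => fderiv_dilatedGraph_apply hs.1.1 hs.1.2 hs.2 l (prodFrame q j)
    fun_prop
  exact (hpoint.eval htangent).congr
    fun s hs => plaqueDensity_pullback_dilation hs.1.1 hs.1.2 hs.2 l φ

end FlowBox

/-- The part of the parameter space of the plaques that `A_l` keeps within distance `r` of the
origin in the coordinates `(z', w')`. -/
def shrunkBox (q : ℕ) (r : ℝ) (l : ℂ) : Set (Cn q × Cn q) :=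
  Metric.ball 0 r ×ˢ Metric.ball 0 (r / ‖l‖)

section ShrunkBox

variable {q : ℕ} {r : ℝ} {l : ℂ}

lemma shrunkBox_subset_graphDomain (hr : r ≤ 1 / 2) (hl : 1 ≤ ‖l‖) :
    shrunkBox q r l ⊆ graphDomain q := by
  rintro p ⟨hz, hw⟩
  rw [mem_ball_zero_iff] at hz hw
  have hwr : ‖p.2‖ < r := by
    rw [lt_div_iff₀' (by linarith)] at hw
    exact (le_mul_of_one_le_left (norm_nonneg _) hl).trans_lt hw
  exact ⟨mem_ball_zero_iff.2 (by linarith),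
    mem_ball_zero_iff.2 (by linarith [norm_add_le p.1 p.2])⟩

lemma measurableSet_shrunkBox : MeasurableSet (shrunkBox q r l) :=
  measurableSet_ball.prod measurableSet_ball

lemma measurableSet_graphDomain (q : ℕ) : MeasurableSet (graphDomain q) :=
  (measurableSet_ball.preimage measurable_fst).inter
    (measurableSet_ball.preimage (measurable_fst.add measurable_snd))

lemma volume_shrunkBox_lt_top : (volume : Measure (Cn q × Cn q)) (shrunkBox q r l) < ⊤ := by
  rw [shrunkBox, Measure.volume_eq_prod, Measure.prod_prod]
  exact ENNReal.mul_lt_top measure_ball_lt_top measure_ball_lt_top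

lemma volume_real_ball (hr : 0 < r) : (volume : Measure (Cn q)).real (Metric.ball 0 r) =
    r ^ (2 * q) * (volume : Measure (Cn q)).real (Metric.ball 0 1) := by
  have hdim : Module.finrank ℝ (Cn q) = 2 * q := by
    simp [Module.finrank_pi_fintype, Complex.finrank_real_complex, mul_comm]
  rw [measureReal_def, Measure.addHaar_ball_of_pos _ _ hr, hdim, ENNReal.toReal_mul,
    ENNReal.toReal_ofReal (by positivity), measureReal_def]

lemma volume_real_shrunkBox_mul (hr : 0 < r) (hl : l ≠ 0) :
    (volume : Measure (Cn q × Cn q)).real (shrunkBox q r l) * ‖l‖ ^ (2 * q) =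
      (volume : Measure (Cn q × Cn q)).real (shrunkBox q r 1) := by
  have hl0 : 0 < ‖l‖ := norm_pos_iff.2 hl
  simp only [shrunkBox, Measure.volume_eq_prod, measureReal_prod_prod, norm_one, div_one]
  rw [volume_real_ball (div_pos hr hl0), volume_real_ball hr, div_pow]
  field_simp

end ShrunkBox

namespace FlowBox

variable {q m : ℕ} {B : FlowBox q m} {a b : Cn m} {l : ℂ} {p : Cn q × Cn q} {r ρ c : ℝ}

lemma dilatedGraph_mem_ball_iff : B.dilatedGraph l a b p ∈ Metric.ball 0 r ↔
    (‖p.1‖ < r ∧ ‖B.h a p.1‖ < r) ∧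
      ‖l‖ * ‖p.2‖ < r ∧ ‖l‖ * ‖B.h b (p.1 + p.2) - B.h a p.1‖ < r := by
  simp [dilatedGraph, Prod.norm_mk, norm_smul]

lemma mem_shrunkBox_of_dilatedGraph_mem (hl : l ≠ 0)
    (hp : B.dilatedGraph l a b p ∈ Metric.ball 0 r) : p ∈ shrunkBox q r l := by
  obtain ⟨⟨hz, -⟩, hw, -⟩ := dilatedGraph_mem_ball_iff.1 hp
  exact ⟨mem_ball_zero_iff.2 hz,
    mem_ball_zero_iff.2 ((lt_div_iff₀' (norm_pos_iff.2 hl)).2 hw)⟩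

lemma graph_mem_ball_of_dilatedGraph_mem (hl : 1 ≤ ‖l‖)
    (hp : B.dilatedGraph l a b p ∈ Metric.ball 0 r) :
    (‖p.1‖ < r ∧ ‖B.h a p.1‖ < r) ∧ ‖p.2‖ < r ∧ ‖B.h b (p.1 + p.2) - B.h a p.1‖ < r := by
  obtain ⟨hz, hw, hg⟩ := dilatedGraph_mem_ball_iff.1 hp
  exact ⟨hz, (le_mul_of_one_le_left (norm_nonneg _) hl).trans_lt hw,
    (le_mul_of_one_le_left (norm_nonneg _) hl).trans_lt hg⟩

lemma mem_graphDomain_of_dilatedGraph_mem (hr : r ≤ 1 / 2) (hl : 1 ≤ ‖l‖)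
    (hp : B.dilatedGraph l a b p ∈ Metric.ball 0 r) : p ∈ graphDomain q :=
  shrunkBox_subset_graphDomain hr hl
    (mem_shrunkBox_of_dilatedGraph_mem (norm_pos_iff.1 (by linarith)) hp)

lemma mem_closedBall_of_dilatedGraph_mem (hr : r ≤ 1 / 16) (hl : 1 ≤ ‖l‖)
    (ha : a ∈ B.transversal) (hb : b ∈ B.transversal)
    (hp : B.dilatedGraph l a b p ∈ Metric.ball 0 r) :
    a ∈ Metric.closedBall 0 (3 / 4) ∧ b ∈ Metric.closedBall 0 (3 / 4) := by
  obtain ⟨⟨hz, hf⟩, hw, hg⟩ := graph_mem_ball_of_dilatedGraph_mem hl hp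
  have hzw := norm_add_le p.1 p.2
  have hna := norm_le_norm_h_add ha (x := p.1) (by linarith)
  have hnb := norm_le_norm_h_add hb (x := p.1 + p.2) (by linarith)
  have hhb := norm_sub_norm_le (B.h b (p.1 + p.2)) (B.h a p.1)
  exact ⟨mem_closedBall_zero_iff.2 (by linarith), mem_closedBall_zero_iff.2 (by linarith)⟩

lemma norm_h_add_sub_h_le (hB : B.IsBiLipschitzOn ρ c) (ha : a ∈ B.transversal)
    (hb : b ∈ B.transversal) {x w : Cn q} (hxρ : ‖x‖ ≤ ρ) (hx : ‖x‖ ≤ 1 / 2)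
    (hxw : ‖x + w‖ ≤ 1 / 2) :
    ‖B.h b (x + w) - B.h a x‖ ≤ 4 * ‖w‖ + c * ‖a - b‖ := by
  have hmove := norm_h_sub_h_le hb hx hxw
  rw [add_sub_cancel_left] at hmove
  have hplaque := (hB.2 a ha b hb x hxρ).2
  rw [norm_sub_rev] at hplaque
  exact (norm_sub_le_norm_sub_add_norm_sub _ (B.h b x) _).trans (add_le_add hmove hplaque)

lemma norm_mul_norm_sub_le (hρ : ρ ≤ 1 / 2) (hB : B.IsBiLipschitzOn ρ c) (hl : 1 ≤ ‖l‖)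
    (ha : a ∈ B.transversal) (hb : b ∈ B.transversal)
    (hp : B.dilatedGraph l a b p ∈ Metric.ball 0 (ρ / 8)) : ‖l‖ * ‖a - b‖ ≤ c := by
  obtain ⟨⟨hz, -⟩, hlw, hlg⟩ := dilatedGraph_mem_ball_iff.1 hp
  obtain ⟨-, hw, -⟩ := graph_mem_ball_of_dilatedGraph_mem hl hp
  have hz0 := norm_nonneg p.1
  have hmove := norm_h_sub_h_le hb (x := p.1) (y := p.1 + p.2) (by linarith)
    (by linarith [norm_add_le p.1 p.2])
  rw [add_sub_cancel_left] at hmove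
  have hplaques : ‖B.h a p.1 - B.h b p.1‖ ≤ 4 * ‖p.2‖ + ‖B.h b (p.1 + p.2) - B.h a p.1‖ := by
    rw [norm_sub_rev] at hmove
    rw [norm_sub_rev (B.h a p.1)]
    exact (norm_sub_le_norm_sub_add_norm_sub _ (B.h b (p.1 + p.2)) _).trans
      (add_le_add_left hmove _)
  have hlower := (hB.2 a ha b hb p.1 (by linarith)).1
  have hone : c⁻¹ * (‖l‖ * ‖a - b‖) ≤ 1 := by
    calc c⁻¹ * (‖l‖ * ‖a - b‖) = ‖l‖ * (c⁻¹ * ‖a - b‖) := by ring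
      _ ≤ ‖l‖ * (4 * ‖p.2‖ + ‖B.h b (p.1 + p.2) - B.h a p.1‖) := by
        gcongr; exact hlower.trans hplaques
      _ ≤ 1 := by linarith
  rwa [inv_mul_le_iff₀ hB.1, mul_one] at hone

lemma norm_mul_norm_fderiv_sub_le (hρ : ρ ≤ 1 / 2) (hB : B.IsBiLipschitzOn ρ c)
    (hl : 1 ≤ ‖l‖) (ha : a ∈ B.transversal) (hb : b ∈ B.transversal)
    (hp : B.dilatedGraph l a b p ∈ Metric.ball 0 (ρ / 8)) :
    ‖l‖ * ‖fderiv ℂ (B.h b) (p.1 + p.2) - fderiv ℂ (B.h a) p.1‖ ≤ 2 + 4 * c ^ 2 / ρ := by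
  obtain ⟨-, hlw, -⟩ := dilatedGraph_mem_ball_iff.1 hp
  obtain ⟨⟨hz, -⟩, hw, -⟩ := graph_mem_ball_of_dilatedGraph_mem hl hp
  have hρ0 : 0 < ρ := by linarith [norm_nonneg p.1]
  have hball : ∀ t ∈ Metric.ball p.1 (ρ / 2), ‖t‖ ≤ 5 / 8 * ρ := fun t ht => by
    linarith [norm_sub_norm_le t p.1, mem_ball_iff_norm.1 ht]
  have hball' : ∀ t ∈ Metric.ball (p.1 + p.2) (ρ / 2), ‖t‖ ≤ 3 / 4 * ρ := fun t ht => by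
    linarith [norm_sub_norm_le t (p.1 + p.2), mem_ball_iff_norm.1 ht, norm_add_le p.1 p.2]
  have hcauchy := norm_fderiv_add_sub_fderiv_le (half_pos hρ0)
    ((B.holomorphic a ha).mono fun t ht => mem_ball_zero_iff.2 (by linarith [hball t ht]))
    ((B.holomorphic b hb).mono fun t ht => mem_ball_zero_iff.2 (by linarith [hball' t ht]))
    fun t ht => norm_h_add_sub_h_le hB ha hb (by linarith [hball t ht]) (by linarith [hball t ht])
      (by linarith [hball t ht, norm_add_le t p.2])
  have hlab := norm_mul_norm_sub_le hρ hB hl ha hb hp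
  calc ‖l‖ * ‖fderiv ℂ (B.h b) (p.1 + p.2) - fderiv ℂ (B.h a) p.1‖
      ≤ ‖l‖ * (2 * (4 * ‖p.2‖ + c * ‖a - b‖) / (ρ / 2)) := by gcongr
    _ = 4 / ρ * (4 * (‖l‖ * ‖p.2‖) + c * (‖l‖ * ‖a - b‖)) := by field_simp; ring
    _ ≤ 4 / ρ * (4 * (ρ / 8) + c * c) := by gcongr; exact hB.1.le
    _ = 2 + 4 * c ^ 2 / ρ := by field_simp; ring

lemma norm_fderiv_dilatedGraph_base_le (hρ : ρ ≤ 1 / 2) (hB : B.IsBiLipschitzOn ρ c)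
    (hl : 1 ≤ ‖l‖) (ha : a ∈ B.transversal) (hb : b ∈ B.transversal)
    (hp : B.dilatedGraph l a b p ∈ Metric.ball 0 (ρ / 8)) (v : Cn q) :
    ‖fderiv ℝ (B.dilatedGraph l a b) p (v, 0)‖ ≤ (4 + 4 * c ^ 2 / ρ) * ‖v‖ := by
  obtain ⟨⟨hz, -⟩, -⟩ := dilatedGraph_mem_ball_iff.1 hp
  have hz0 := norm_nonneg p.1
  have hpD := mem_graphDomain_of_dilatedGraph_mem (by linarith) hl hp
  have hc : 0 ≤ 4 * c ^ 2 / ρ := div_nonneg (by positivity) (by linarith)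
  have hslope : ‖fderiv ℂ (B.h a) p.1 v‖ ≤ (4 + 4 * c ^ 2 / ρ) * ‖v‖ :=
    ContinuousLinearMap.le_of_opNorm_le _
      ((norm_fderiv_h_le ha (by linarith)).trans (le_add_of_nonneg_right hc)) v
  have hdifference : ‖l‖ * ‖(fderiv ℂ (B.h b) (p.1 + p.2) - fderiv ℂ (B.h a) p.1) v‖ ≤
      (4 + 4 * c ^ 2 / ρ) * ‖v‖ := by
    rw [← norm_smul, ← smul_apply]
    refine ContinuousLinearMap.le_of_opNorm_le _ ?_ v
    rw [norm_smul]
    linarith [norm_mul_norm_fderiv_sub_le hρ hB hl ha hb hp]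
  have hv : ‖v‖ ≤ (4 + 4 * c ^ 2 / ρ) * ‖v‖ :=
    le_mul_of_one_le_left (norm_nonneg v) (by linarith)
  rw [sub_apply] at hdifference
  simp only [fderiv_dilatedGraph_apply ha hb hpD, Prod.norm_mk, norm_smul, add_zero, norm_zero,
    mul_zero]
  exact max_le (max_le hv hslope) (max_le ((norm_nonneg v).trans hv) hdifference)

lemma norm_fderiv_dilatedGraph_fibre_le (hl : 1 ≤ ‖l‖) (ha : a ∈ B.transversal)
    (hb : b ∈ B.transversal) (hpD : p ∈ graphDomain q) (hp : ‖p.1 + p.2‖ ≤ 1 / 2) (v : Cn q) :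
    ‖fderiv ℝ (B.dilatedGraph l a b) p (0, v)‖ ≤ 4 * ‖l‖ * ‖v‖ := by
  have hslope : ‖l‖ * ‖fderiv ℂ (B.h b) (p.1 + p.2) v‖ ≤ ‖l‖ * (4 * ‖v‖) := by
    gcongr
    exact ContinuousLinearMap.le_of_opNorm_le _ (norm_fderiv_h_le hb hp) v
  have hpos : 0 ≤ ‖l‖ * ‖v‖ := by positivity
  simp only [fderiv_dilatedGraph_apply ha hb hpD, Prod.norm_mk, norm_smul, zero_add, map_zero,
    norm_zero, sub_zero]
  refine max_le (max_le ?_ ?_) (max_le ?_ ?_) <;> linarith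

end FlowBox

/-- The open ball of radius `r` about the origin, a polydisc in the coordinates `(z, w)`. -/
def originBox (q m : ℕ) (r : ℝ) : Opens (Coord q m × Coord q m) :=
  ⟨Metric.ball 0 r, Metric.isOpen_ball⟩

lemma originBox_subset_image_dilation {q m : ℕ} {r : ℝ} (hr : r ≤ 1 / 2) {l : ℂ}
    (hl : 1 ≤ ‖l‖) :
    (originBox q m r : Set (Coord q m × Coord q m)) ⊆ dilation l '' productBox q m := by
  rintro ⟨z, w⟩ h
  obtain ⟨hz, hw⟩ : ‖z‖ < r ∧ ‖w‖ < r := by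
    simpa [originBox, Prod.norm_mk] using h
  have hbox : ∀ x : Coord q m, ‖x‖ < 1 → x ∈ polydisc q ×ˢ polydisc m := fun x hx => by
    simpa [polydisc, Prod.norm_def] using hx
  have hshrink : ‖l⁻¹ • w‖ ≤ ‖w‖ := by
    rw [norm_smul, norm_inv]
    exact mul_le_of_le_one_left (norm_nonneg _) (inv_le_one_of_one_le₀ hl)
  have hl0 : l ≠ 0 := norm_pos_iff.1 (by linarith)
  exact ⟨(z, l⁻¹ • w),
    ⟨hbox z (by linarith), hbox _ (by linarith [norm_add_le z (l⁻¹ • w)])⟩,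
    by simp [dilation, hl0]⟩

namespace FlowBox

section Density

variable {q m : ℕ} {B : FlowBox q m} {ρ c : ℝ} {l : ℂ} {s : Cn m × Cn m} {p : Cn q × Cn q}

lemma norm_plaqueDensity_pullback_dilation_le (hρ : ρ ≤ 1 / 2) (hB : B.IsBiLipschitzOn ρ c)
    (hl : 1 ≤ ‖l‖) (hs : s ∈ B.transversal ×ˢ B.transversal)
    (φ : Coord q m × Coord q m → Covector (Coord q m × Coord q m) (2 * q + 2 * q))
    (hp : B.dilatedGraph l s.1 s.2 p ∈ Metric.ball 0 (ρ / 8)) :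
    ‖B.plaqueDensity (s.1, s.2 - s.1) (pullback (dilation l) φ) p‖ ≤
      ‖φ (B.dilatedGraph l s.1 s.2 p)‖ *
        ((4 + 4 * c ^ 2 / ρ) ^ (2 * q) * (4 * ‖l‖) ^ (2 * q)) := by
  obtain ⟨⟨hz, -⟩, hw, -⟩ := graph_mem_ball_of_dilatedGraph_mem hl hp
  have hz0 := norm_nonneg p.1
  have hpD := mem_graphDomain_of_dilatedGraph_mem (by linarith) hl hp
  rw [plaqueDensity_pullback_dilation hs.1 hs.2 hpD]
  exact norm_apply_prodFrame_le _
    (norm_fderiv_dilatedGraph_base_le hρ hB hl hs.1 hs.2 hp)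
    (norm_fderiv_dilatedGraph_fibre_le hl hs.1 hs.2 hpD (by linarith [norm_add_le p.1 p.2]))

variable {r : ℝ} {φ : TestForm (originBox q m r) (2 * q + 2 * q)}

lemma dilatedGraph_mem_ball_of_plaqueDensity_ne_zero
    (hs : s ∈ B.transversal ×ˢ B.transversal) (hp : p ∈ graphDomain q)
    (h : B.plaqueDensity (s.1, s.2 - s.1) (pullback (dilation l) φ) p ≠ 0) :
    B.dilatedGraph l s.1 s.2 p ∈ Metric.ball 0 r := by
  rw [plaqueDensity_pullback_dilation hs.1 hs.2 hp] at h
  exact TestForm.mem_of_apply_ne_zero (φ := φ) fun h0 => h (by rw [h0]; rfl)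

lemma norm_plaqueDensity_le_supNorm (hρ : ρ ≤ 1 / 2) (hB : B.IsBiLipschitzOn ρ c)
    (hl : 1 ≤ ‖l‖) (hs : s ∈ B.transversal ×ˢ B.transversal) (hp : p ∈ graphDomain q)
    (φ : TestForm (originBox q m (ρ / 8)) (2 * q + 2 * q)) :
    ‖B.plaqueDensity (s.1, s.2 - s.1) (pullback (dilation l) φ) p‖ ≤
      TestForm.supNorm φ * ((4 + 4 * c ^ 2 / ρ) ^ (2 * q) * (4 * ‖l‖) ^ (2 * q)) := by
  have hpow : 0 ≤ (4 + 4 * c ^ 2 / ρ) ^ (2 * q) * (4 * ‖l‖) ^ (2 * q) :=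
    mul_nonneg ((even_two_mul q).pow_nonneg _) (by positivity)
  by_cases h : B.plaqueDensity (s.1, s.2 - s.1) (pullback (dilation l) φ) p = 0
  · rw [h, norm_zero]
    exact mul_nonneg (TestForm.supNorm_nonneg φ) hpow
  · exact (norm_plaqueDensity_pullback_dilation_le hρ hB hl hs φ
      (dilatedGraph_mem_ball_of_plaqueDensity_ne_zero hs hp h)).trans
        (mul_le_mul_of_nonneg_right (TestForm.norm_apply_le_supNorm φ _) hpow)

lemma plaqueDensity_eq_zero_of_notMem_shrunkBox (hl : l ≠ 0)
    (hs : s ∈ B.transversal ×ˢ B.transversal) (hp : p ∈ graphDomain q \ shrunkBox q r l) :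
    B.plaqueDensity (s.1, s.2 - s.1) (pullback (dilation l) φ) p = 0 :=
  of_not_not fun h => hp.2 <| mem_shrunkBox_of_dilatedGraph_mem hl <|
    dilatedGraph_mem_ball_of_plaqueDensity_ne_zero hs hp.1 h

lemma mem_nearDiagonal_of_plaqueDensity_ne_zero (hρ : ρ ≤ 1 / 2) (hB : B.IsBiLipschitzOn ρ c)
    (hl : 1 ≤ ‖l‖) (hs : s ∈ B.transversal ×ˢ B.transversal) (hp : p ∈ graphDomain q)
    {φ : TestForm (originBox q m (ρ / 8)) (2 * q + 2 * q)}
    (h : B.plaqueDensity (s.1, s.2 - s.1) (pullback (dilation l) φ) p ≠ 0) :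
    s ∈ nearDiagonal (Metric.closedBall 0 (3 / 4)) (c / ‖l‖) := by
  have hball := dilatedGraph_mem_ball_of_plaqueDensity_ne_zero hs hp h
  refine ⟨mem_closedBall_of_dilatedGraph_mem (by linarith) hl hs.1 hs.2 hball, ?_⟩
  rw [dist_eq_norm, le_div_iff₀' (by linarith)]
  exact norm_mul_norm_sub_le hρ hB hl hs.1 hs.2 hball

lemma integrableOn_plaqueDensity (hρ : ρ ≤ 1 / 2) (hB : B.IsBiLipschitzOn ρ c) (hl : 1 ≤ ‖l‖)
    (hs : s ∈ B.transversal ×ˢ B.transversal)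
    (φ : TestForm (originBox q m (ρ / 8)) (2 * q + 2 * q)) :
    IntegrableOn (B.plaqueDensity (s.1, s.2 - s.1) (pullback (dilation l) φ))
      (graphDomain q) := by
  have hsub := shrunkBox_subset_graphDomain (q := q) (r := ρ / 8) (by linarith) hl
  have hcont : ContinuousOn (B.plaqueDensity (s.1, s.2 - s.1) (pullback (dilation l) φ))
      (graphDomain q) :=
    (continuousOn_plaqueDensity B l φ.continuous).comp (f := fun p => (s, p)) (by fun_prop)
      fun p hp => ⟨hs, hp⟩
  refine IntegrableOn.of_forall_sdiff_eq_zero ?_ (measurableSet_graphDomain q) fun p hp =>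
    plaqueDensity_eq_zero_of_notMem_shrunkBox (norm_pos_iff.1 (by linarith)) hs hp
  exact IntegrableOn.of_bound volume_shrunkBox_lt_top
    ((hcont.mono hsub).aestronglyMeasurable measurableSet_shrunkBox) _
    ((ae_restrict_iff' measurableSet_shrunkBox).2 (Eventually.of_forall fun p hp =>
      norm_plaqueDensity_le_supNorm hρ hB hl hs (hsub hp) φ))

lemma exists_norm_plaqueCurrent_le (hρ0 : 0 < ρ) (hρ : ρ ≤ 1 / 2)
    (hB : B.IsBiLipschitzOn ρ c) :
    ∃ M : ℝ, ∀ l : ℂ, 1 ≤ ‖l‖ → ∀ s ∈ B.transversal ×ˢ B.transversal,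
      ∀ φ : TestForm (originBox q m (ρ / 8)) (2 * q + 2 * q),
        ‖B.plaqueCurrent (s.1, s.2 - s.1) (pullback (dilation l) φ)‖ ≤
          (nearDiagonal (Metric.closedBall 0 (3 / 4)) (c / ‖l‖)).indicator
            (fun _ => M * TestForm.supNorm φ) s := by
  refine ⟨(4 + 4 * c ^ 2 / ρ) ^ (2 * q) * 4 ^ (2 * q) *
    (volume : Measure (Cn q × Cn q)).real (shrunkBox q (ρ / 8) 1), fun l hl s hs φ => ?_⟩
  have hl0 : l ≠ 0 := norm_pos_iff.1 (by linarith)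
  have hsub := shrunkBox_subset_graphDomain (q := q) (r := ρ / 8) (by linarith) hl
  by_cases hnear : s ∈ nearDiagonal (Metric.closedBall 0 (3 / 4)) (c / ‖l‖)
  · rw [Set.indicator_of_mem hnear, plaqueCurrent, setIntegral_eq_of_subset_of_forall_sdiff_eq_zero
      (measurableSet_graphDomain q) hsub fun p hp =>
        plaqueDensity_eq_zero_of_notMem_shrunkBox hl0 hs hp]
    refine (norm_setIntegral_le_of_norm_le_const volume_shrunkBox_lt_top fun p hp =>
      norm_plaqueDensity_le_supNorm hρ hB hl hs (hsub hp) φ).trans_eq ?_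
    rw [← volume_real_shrunkBox_mul (by positivity) hl0, mul_pow]
    ring
  · rw [Set.indicator_of_notMem hnear, plaqueCurrent, setIntegral_eq_zero_of_forall_eq_zero
      fun p hp => of_not_not fun h =>
        hnear (mem_nearDiagonal_of_plaqueDensity_ne_zero hρ hB hl hs hp h), norm_zero]

end Density

end FlowBox

/-! ### The dilated product cycle -/

/-- The change of parameters `(a, b) ↦ (a, b - a)`. -/
def shearEquiv (m : ℕ) : Cn m × Cn m ≃ᵐ Cn m × Cn m where
  toFun p := (p.1, p.2 - p.1)
  invFun p := (p.1, p.2 + p.1)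
  left_inv p := by simp
  right_inv p := by simp
  measurable_toFun := measurable_fst.prodMk (measurable_snd.sub measurable_fst)
  measurable_invFun := measurable_fst.prodMk (measurable_snd.add measurable_fst)

lemma productMeasure_eq_map {m : ℕ} (μ : Measure (Cn m)) :
    productMeasure μ = (μ.prod μ).map (shearEquiv m) :=
  rfl

namespace FlowBox

section ProductCycle

variable {q m : ℕ} {B : FlowBox q m} {μ : Measure (Cn m)}

lemma PairingConverges.productCycle_add
    {φ ψ : Coord q m × Coord q m → Covector (Coord q m × Coord q m) (2 * q + 2 * q)}
    (hφ : B.PairingConverges μ φ) (hψ : B.PairingConverges μ ψ) :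
    B.productCycle μ (φ + ψ) = B.productCycle μ φ + B.productCycle μ ψ := by
  rw [productCycle, productCycle, productCycle, ← integral_add hφ.2 hψ.2]
  refine integral_congr_ae ?_
  filter_upwards [hφ.1, hψ.1] with α hφα hψα
  exact integral_add hφα hψα

lemma productCycle_smul (B : FlowBox q m) (μ : Measure (Cn m)) (r : ℝ)
    (φ : Coord q m × Coord q m → Covector (Coord q m × Coord q m) (2 * q + 2 * q)) :
    B.productCycle μ (r • φ) = r • B.productCycle μ φ := by
  rw [productCycle, productCycle, ← integral_smul]
  exact integral_congr_ae (Eventually.of_forall fun α =>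
    integral_smul r (B.plaqueDensity α φ))

lemma ae_mem_transversal_prod (hμ : μ B.transversalᶜ = 0) :
    ∀ᵐ s ∂(μ.prod μ), s ∈ B.transversal ×ˢ B.transversal := by
  have hae : ∀ᵐ a ∂μ, a ∈ B.transversal := hμ
  exact (Measure.quasiMeasurePreserving_fst.ae hae).and
    (Measure.quasiMeasurePreserving_snd.ae hae)

variable [SFinite μ]

lemma aestronglyMeasurable_plaqueCurrent (hμ : μ B.transversalᶜ = 0) (l : ℂ)
    {φ : Coord q m × Coord q m → Covector (Coord q m × Coord q m) (2 * q + 2 * q)}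
    (hφ : Continuous φ) :
    AEStronglyMeasurable
      (fun s => B.plaqueCurrent (s.1, s.2 - s.1) (pullback (dilation l) φ)) (μ.prod μ) :=
  aestronglyMeasurable_setIntegral_of_continuousOn_prod (ae_mem_transversal_prod hμ)
    (measurableSet_graphDomain q) (continuousOn_plaqueDensity B l hφ)

variable {ρ c : ℝ}

lemma pairingConverges_pullback_dilation (hρ0 : 0 < ρ) (hρ : ρ ≤ 1 / 2)
    (hB : B.IsBiLipschitzOn ρ c) (hμ : μ B.transversalᶜ = 0)
    (hfin : μ (Metric.closedBall 0 (3 / 4)) < ⊤) {l : ℂ} (hl : 1 ≤ ‖l‖)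
    (φ : TestForm (originBox q m (ρ / 8)) (2 * q + 2 * q)) :
    B.PairingConverges μ (pullback (dilation l) φ) := by
  obtain ⟨M, hM⟩ := exists_norm_plaqueCurrent_le hρ0 hρ hB
  have hae := ae_mem_transversal_prod hμ
  rw [PairingConverges, productMeasure_eq_map, (shearEquiv m).measurableEmbedding.ae_map_iff,
    integrable_map_equiv]
  refine ⟨hae.mono fun s hs => integrableOn_plaqueDensity hρ hB hl hs φ,
    Integrable.mono' ?_ (aestronglyMeasurable_plaqueCurrent hμ l φ.continuous)
      (hae.mono fun s hs => hM l hl s hs φ)⟩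
  exact (integrable_indicator_iff (measurableSet_nearDiagonal measurableSet_closedBall _)).2
    (integrableOn_const (prod_nearDiagonal_lt_top hfin _).ne)

lemma exists_norm_productCycle_le (hρ0 : 0 < ρ) (hρ : ρ ≤ 1 / 2)
    (hB : B.IsBiLipschitzOn ρ c) (hμ : μ B.transversalᶜ = 0)
    (hfin : μ (Metric.closedBall 0 (3 / 4)) < ⊤) :
    ∃ M : ℝ, ∀ l : ℂ, 1 ≤ ‖l‖ → ∀ φ : TestForm (originBox q m (ρ / 8)) (2 * q + 2 * q),
      ‖B.productCycle μ (pullback (dilation l) φ)‖ ≤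
        M * (μ.prod μ).real (nearDiagonal (Metric.closedBall 0 (3 / 4)) (c / ‖l‖)) *
          TestForm.supNorm φ := by
  obtain ⟨M, hM⟩ := exists_norm_plaqueCurrent_le hρ0 hρ hB
  refine ⟨M, fun l hl φ => ?_⟩
  have hmeas : MeasurableSet (nearDiagonal (Metric.closedBall (0 : Cn m) (3 / 4)) (c / ‖l‖)) :=
    measurableSet_nearDiagonal measurableSet_closedBall _
  rw [productCycle, productMeasure_eq_map, integral_map_equiv]
  refine (norm_integral_le_of_norm_le ((integrable_indicator_iff hmeas).2
    (integrableOn_const (prod_nearDiagonal_lt_top hfin _).ne))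
    ((ae_mem_transversal_prod hμ).mono fun s hs => hM l hl s hs φ)).trans_eq ?_
  rw [integral_indicator_const _ hmeas, smul_eq_mul]
  ring

lemma exists_current_eq_pushforward_dilation (hρ0 : 0 < ρ) (hρ : ρ ≤ 1 / 2)
    (hB : B.IsBiLipschitzOn ρ c) (hμ : μ B.transversalᶜ = 0)
    (hfin : μ (Metric.closedBall 0 (3 / 4)) < ⊤) {l : ℂ} (hl : 1 ≤ ‖l‖) :
    ∃ T : Current (originBox q m (ρ / 8)) (2 * q + 2 * q),
      ∀ φ, T φ = pushforward (dilation l) (B.productCycle μ) φ := by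
  have hconv := pairingConverges_pullback_dilation hρ0 hρ hB hμ hfin hl
  obtain ⟨M, hM⟩ := exists_norm_productCycle_le hρ0 hρ hB hμ hfin
  let S : TestForm (originBox q m (ρ / 8)) (2 * q + 2 * q) →ₗ[ℝ] ℂ :=
    { toFun := fun φ => pushforward (dilation l) (B.productCycle μ) φ
      map_add' := fun φ ψ => by
        simpa only [pushforward, ← pullback_add, ← FunLike.coe_add] using
          (hconv φ).productCycle_add (hconv ψ)
      map_smul' := fun r φ => by
        simpa only [pushforward, ← pullback_smul, ← FunLike.coe_smul, RingHom.id_apply] using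
          productCycle_smul B μ r (pullback (dilation l) φ) }
  exact ⟨⟨S, TestForm.continuous_of_norm_le_supNorm (hM l hl)⟩, fun φ => rfl⟩

lemma tendsto_productCycle_pullback_dilation [NullSingletonClass μ] (hρ0 : 0 < ρ)
    (hρ : ρ ≤ 1 / 2) (hB : B.IsBiLipschitzOn ρ c) (hμ : μ B.transversalᶜ = 0)
    (hfin : μ (Metric.closedBall 0 (3 / 4)) < ⊤)
    (φ : TestForm (originBox q m (ρ / 8)) (2 * q + 2 * q)) :
    Tendsto (fun l : ℂ => B.productCycle μ (pullback (dilation l) φ))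
      (Bornology.cobounded ℂ) (𝓝 0) := by
  obtain ⟨M, hM⟩ := exists_norm_productCycle_le hρ0 hρ hB hμ hfin
  have hwidth : Tendsto (fun l : ℂ => c / ‖l‖) (Bornology.cobounded ℂ) (𝓝[>] 0) := by
    refine tendsto_nhdsWithin_iff.2 ⟨tendsto_norm_cobounded_atTop.const_div_atTop c, ?_⟩
    filter_upwards [tendsto_norm_cobounded_atTop.eventually_gt_atTop 0] with l hl
    exact div_pos hB.1 hl
  have hmass : Tendsto (fun l : ℂ =>
      (μ.prod μ).real (nearDiagonal (Metric.closedBall 0 (3 / 4)) (c / ‖l‖)))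
      (Bornology.cobounded ℂ) (𝓝 0) :=
    (ENNReal.tendsto_toReal ENNReal.zero_ne_top).comp
      ((tendsto_prod_nearDiagonal measurableSet_closedBall hfin).comp hwidth)
  refine squeeze_zero_norm' ?_ (by
    simpa only [mul_zero, zero_mul] using (hmass.const_mul M).mul_const (TestForm.supNorm φ))
  filter_upwards [tendsto_norm_cobounded_atTop.eventually_ge_atTop 1] with l hl
  exact hM l hl φ

end ProductCycle

end FlowBox

end FoliatedCycle

end

open FoliatedCycle in
theorem mainTheorem2_general {q m : ℕ} (B : FlowBox q m) {ρ c : ℝ} (hρ : 0 < ρ)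
    (hB : B.IsBiLipschitzOn ρ c) (μ : Measure (Cn m)) (hdiff : ∀ a, μ {a} = 0)
    (hμ : μ B.transversalᶜ = 0) (hfin : ∀ C ⊆ polydisc m, IsCompact C → μ C < ⊤) :
    ∃ U : Opens (Coord q m × Coord q m), 0 ∈ U ∧
      (∀ l : ℂ, 1 ≤ ‖l‖ →
        (U : Set (Coord q m × Coord q m)) ⊆ dilation l '' productBox q m) ∧
      ∃ T : ℂ → Current U (2 * q + 2 * q),
        (∀ l : ℂ, 1 ≤ ‖l‖ → ∀ φ : TestForm U (2 * q + 2 * q),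
          B.PairingConverges μ (pullback (dilation l) φ) ∧
            T l φ = pushforward (dilation l) (B.productCycle μ) φ) ∧
        ∀ φ : TestForm U (2 * q + 2 * q),
          Tendsto (fun l => T l φ) (Bornology.cobounded ℂ) (𝓝 0) := by
  have : SigmaFinite μ := sigmaFinite_of_isSigmaCompact
    (isSigmaCompact_of_isOpen Metric.isOpen_ball)
    (measure_mono_null (Set.compl_subset_compl.2 B.transversal_subset) hμ) hfin
  have : NullSingletonClass μ := ⟨hdiff⟩
  have hfin' : μ (Metric.closedBall 0 (3 / 4)) < ⊤ :=
    hfin _ (Metric.closedBall_subset_ball (by norm_num)) (isCompact_closedBall 0 _)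
  obtain ⟨σ, hσ0, hσ, hBσ⟩ : ∃ σ, 0 < σ ∧ σ ≤ 1 / 2 ∧ B.IsBiLipschitzOn σ c :=
    ⟨min ρ (1 / 2), by positivity, min_le_right _ _, hB.mono (min_le_left _ _)⟩
  choose! T hT using fun l : ℂ =>
    FlowBox.exists_current_eq_pushforward_dilation (l := l) hσ0 hσ hBσ hμ hfin'
  refine ⟨originBox q m (σ / 8), Metric.mem_ball_self (by positivity),
    fun l hl => originBox_subset_image_dilation (by linarith) hl, T,
    fun l hl φ => ⟨FlowBox.pairingConverges_pullback_dilation hσ0 hσ hBσ hμ hfin' hl φ, hT l hl φ⟩,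
    fun φ => (FlowBox.tendsto_productCycle_pullback_dilation hσ0 hσ hBσ hμ hfin' φ).congr' ?_⟩
  filter_upwards [tendsto_norm_cobounded_atTop.eventually_ge_atTop 1] with l hl
  exact (hT l hl φ).symm

/-- Let `B` be a flow box of a Lipschitz lamination and `μ` a diffuse positive Radon measure on
its transversal. Then there is a neighbourhood `U` of the origin, contained in the dilated boxes
`A_l (B × B)` for `|l| ≥ 1`, on which all `(A_l)_* (T ⊗ T)`, `|l| ≥ 1`, are well defined currents
that converge weakly to `0` as `|l| → ∞`. -/
theorem mainTheorem2 {q m : ℕ} (B : FoliatedCycle.FlowBox q m) (hB : B.IsLipschitz)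
    (μ : Measure (Fin m → ℂ)) (hdiff : ∀ a, μ {a} = 0) (hμ : μ B.transversalᶜ = 0)
    (hfin : ∀ C ⊆ FoliatedCycle.polydisc m, IsCompact C → μ C < ⊤) :
    ∃ U : Opens (FoliatedCycle.Coord q m × FoliatedCycle.Coord q m), 0 ∈ U ∧
      (∀ l : ℂ, 1 ≤ ‖l‖ →
        (U : Set (FoliatedCycle.Coord q m × FoliatedCycle.Coord q m)) ⊆
          FoliatedCycle.dilation l '' FoliatedCycle.productBox q m) ∧
      ∃ T : ℂ → FoliatedCycle.Current U (2 * q + 2 * q),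
        (∀ l : ℂ, 1 ≤ ‖l‖ → ∀ φ : FoliatedCycle.TestForm U (2 * q + 2 * q),
          B.PairingConverges μ (FoliatedCycle.pullback (FoliatedCycle.dilation l) φ) ∧
          T l φ =
            FoliatedCycle.pushforward (FoliatedCycle.dilation l) (B.productCycle μ) φ) ∧
        ∀ φ : FoliatedCycle.TestForm U (2 * q + 2 * q),
          Tendsto (fun l => T l φ) (Bornology.cobounded ℂ) (𝓝 0) := by
  obtain ⟨c, hc⟩ := hB (1 / 2) (by norm_num) (by norm_num)
  exact mainTheorem2_general B one_half_pos hc μ hdiff hμ hfin
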